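/- All spaces are real. For a Banach space $X$ with closed unit ball $B_X$ and $x\in X$ with $\|x\|=1$: $x$ is a *super Daugavet point* if $\sup_{y\in W}\|x-y\|=2$ for every non-empty relatively weakly open subset $W$ of $B_X$. A *slice* of a bounded non-empty convex set $C$ is a set $\{y\in C: f(y)>\sup_C f-\delta\}$ with $f\in X^*$, $\delta>0$; a *convex combination of slices* (ccs) of $C$ is a set $\sum_{i=1}^n\lambda_iS_i$ with $\lambda_i\in(0,1]$, $\sum_i\lambda_i=1$ and slices $S_i$ of $C$; and $x$ is a *ccs $\Delta$-point* if $\sup_{y\in D}\|x-y\|=2$ for every ccs $D$ of $B_X$ containing $x$. *The set $K_0$.* Let $(\varepsilon_n)_{n\ge1}$ be a nonincreasing null sequence of positive reals, and let $(e_n)_{n\ge 1}$ be the unit vectors of $c_0$. Put $K_1=\{e_1\}$, $g_1=e_1$, $m_1=l_1=1$. Given $K_n$, $m_n$, $l_n$ and $g_1,\dots,g_{l_n}\in K_n$, put $$K_{n+1}=\operatorname{conv}\bigl(K_n\cup\{g_i+e_{m_n+i}:1\le i\le l_n\}\bigr),\qquad m_{n+1}=m_n+l_n,$$ and choose $l_{n+1}\ge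 l_n$ and $g_{l_n+1},\dots,g_{l_{n+1}}\in K_{n+1}$ such that $\{g_1,\dots,g_{l_{n+1}}\}$ is an $\varepsilon_{n+1}$-net of $K_{n+1}$. Let $K_0=\overline{\bigcup_nK_n}\subset c_0$. *The renorming.* Let $V_1,V_2,\dots$ be pairwise disjoint open subsets of $[0,1]$ not containing $0$, and let $h_n\in C[0,1]$ satisfy $0\le h_n\le1$, $\|h_n\|_\infty=1$ and $h_n=0$ outside $V_n$. Through the linear isometry $c_0\to C[0,1]$, $e_n\mapsto h_n$, regard $K_0$ as a subset of $C[0,1]$. For $0<\varepsilon<1$ let $$B_\varepsilon=\overline{\operatorname{conv}}\Bigl(2\bigl(K_0-\tfrac{\mathbf 1}{2}\bigr)\cup2\bigl(-K_0+\tfrac{\mathbf 1}{2}\bigr)\cup\bigl((1-\varepsilon)B_{C[0,1]}+\varepsilon B_{\ker\delta_0}\bigr)\Bigr),$$ where $\mathbf 1$ is the constant function $1$ and $\ker\delta_0=\{f\in C[0,1]:f(0)=0\}$, and let $\|\cdot\|_\varepsilon$ be the norm on $C[0,1]$ whose closed unit ball is $B_\varepsilon$. **Theorem.** For all choices as above,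 the space $(C[0,1],\|\cdot\|_\varepsilon)$ satisfies: 1. every element of $2(K_0-\frac{\mathbf 1}{2})$ is a super Daugavet point; 2. for every $\eta>0$ there is a convex combination of slices $D$ of $B_\varepsilon$ such that $D\cap2(K_0-\frac{\mathbf 1}{2})\ne\emptyset$ and the $\|\cdot\|_\varepsilon$-diameter of $D$ is less than $\eta$. In particular, this space has super Daugavet points which are not ccs $\Delta$-points; hence there exist a Banach space and a super Daugavet point of it which is not a ccs $\Delta$-point. -/

import Mathlib

noncomputable section

/-! ### Diametral notions in a real normed space -/

section Diametral

variable {X : Type*} [NormedAddCommGroup X] [NormedSpace ℝ X]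

/-- `S` is a slice of `C`: `S = {x ∈ C | f x > sup_C f - δ}` for some continuous linear
functional `f` and some `δ > 0`. -/
def IsSlice (C S : Set X) : Prop :=
  ∃ (f : X →L[ℝ] ℝ) (δ : ℝ), 0 < δ ∧ S = {x | x ∈ C ∧ sSup (f '' C) - δ < f x}

/-- `D` is a convex combination of slices of `C`: `D = ∑ i, lam i • S i` (Minkowski sum) with
`lam i ∈ (0, 1]`, `∑ i, lam i = 1` and every `S i` a slice of `C`. -/
def IsCCS (C D : Set X) : Prop :=
  ∃ (n : ℕ) (lam : Fin n → ℝ) (S : Fin n → Set X),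
    (∀ i, 0 < lam i ∧ lam i ≤ 1) ∧ ∑ i, lam i = 1 ∧ (∀ i, IsSlice C (S i)) ∧
      D = {z | ∃ x : Fin n → X, (∀ i, x i ∈ S i) ∧ z = ∑ i, lam i • x i}

/-- `W` is a non-empty relatively weakly open subset of `C`. -/
def IsRelWeaklyOpen (C W : Set X) : Prop :=
  W.Nonempty ∧ ∃ U : Set (WeakSpace ℝ X), IsOpen U ∧ W = C ∩ toWeakSpace ℝ X ⁻¹' U

/-- `x` is a super Daugavet point: `x` is in the unit sphere and `sup_{y ∈ W} ‖x - y‖ = 2` for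
every non-empty relatively weakly open subset `W` of the unit ball. -/
def IsSuperDaugavetPoint (x : X) : Prop :=
  ‖x‖ = 1 ∧ ∀ W : Set X, IsRelWeaklyOpen (Metric.closedBall 0 1) W →
    IsLUB ((fun y => ‖x - y‖) '' W) 2

/-- `x` is a ccs Δ-point: `x` is in the unit sphere and `sup_{y ∈ D} ‖x - y‖ = 2` for
every convex combination of slices `D` of the unit ball which contains `x`. -/
def IsCCSDeltaPoint (x : X) : Prop :=
  ‖x‖ = 1 ∧ ∀ D : Set X, IsCCS (Metric.closedBall 0 1) D → x ∈ D →
    IsLUB ((fun y => ‖x - y‖) '' D) 2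

end Diametral

namespace AOR

open scoped ZeroAtInfty
open Filter Topology

/-! ### The construction of Argyros, Odell and Rosenthal in `c₀`

Indices of coordinates, of stages and of the sequence `g` start at `0` instead of `1`. -/

/-- The real space `c₀` with the supremum norm. -/
abbrev C0 : Type := C₀(ℕ, ℝ)

/-- The unit vectors of `c₀`. -/
def e (k : ℕ) : C0 where
  toFun := Pi.single k 1
  continuous_toFun := continuous_of_discreteTopology
  zero_at_infty' := by
    rw [cocompact_eq_cofinite, Nat.cofinite_eq_atTop]
    refine tendsto_const_nhds.congr' ?_
    filter_upwards [eventually_gt_atTop k] with j hj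
    simp [hj.ne']

/-- `stageM l n` is the number of coordinates used by stage `n`:
`stageM l 0 = 1` and `stageM l (n + 1) = stageM l n + l n`. -/
def stageM (l : ℕ → ℕ) : ℕ → ℕ
  | 0 => 1
  | n + 1 => stageM l n + l n

/-- The increasing sequence of sets: the first one is `{e 0}`, and the one of stage `n + 1` is
the convex hull of the one of stage `n` and of the points `g i + e (m n + i)`, `i < l n`. -/
def stageK (l : ℕ → ℕ) (g : ℕ → C0) : ℕ → Set C0
  | 0 => {e 0}
  | n + 1 => convexHull ℝ (stageK l g n ∪ {x | ∃ i < l n, x = g i + e (stageM l n + i)})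

/-- The choices made in the construction: a nonincreasing null sequence `eps` of positive
reals, and, for every stage `n`, a finite `eps n`-net `g 0, …, g (l n - 1)` of the set of that
stage, the nets being initial segments of one sequence `g` starting with `e 0`. -/
structure Construction where
  eps : ℕ → ℝ
  eps_pos : ∀ n, 0 < eps n
  eps_antitone : Antitone eps
  eps_tendsto : Tendsto eps atTop (𝓝 0)
  l : ℕ → ℕ
  l_zero : l 0 = 1
  l_mono : Monotone l
  g : ℕ → C0
  g_zero : g 0 = e 0
  g_mem : ∀ n, ∀ i < l n, g i ∈ stageK l g n
  g_net : ∀ n, ∀ x ∈ stageK l g n, ∃ i < l n, ‖x - g i‖ ≤ eps n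

/-- The set `K₀` in `c₀`. -/
def Construction.K0 (A : Construction) : Set C0 :=
  closure (⋃ n, stageK A.l A.g n)

theorem stageK_le (l : ℕ → ℕ) (g : ℕ → C0)
    (hg : ∀ n, ∀ i < l n, g i ∈ stageK l g n) (n : ℕ) :
    ∀ x ∈ stageK l g n, (∀ k, 0 ≤ x k ∧ x k ≤ 1) ∧ ∀ k, stageM l n ≤ k → x k = 0 := by
  induction n with
  | zero =>
    rintro x hx
    obtain rfl : x = e 0 := hx
    refine ⟨fun k => ?_, fun k hk => ?_⟩
    · by_cases h : k = 0 <;> simp [e, h]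
    · have : k ≠ 0 := by simp [stageM] at hk; omega
      simp [e, this]
  | succ n ih =>
    intro x hx
    have hconv : Convex ℝ {x : C0 | (∀ k, 0 ≤ x k ∧ x k ≤ 1) ∧
        ∀ k, stageM l (n + 1) ≤ k → x k = 0} := by
      rintro x ⟨hx, hx'⟩ y ⟨hy, hy'⟩ a b ha hb hab
      refine ⟨fun k => ?_, fun k hk => ?_⟩
      · simp only [ZeroAtInftyContinuousMap.add_apply, ZeroAtInftyContinuousMap.smul_apply,
          smul_eq_mul]
        have h1 := hx k
        have h2 := hy k
        constructor
        · nlinarith [mul_nonneg ha h1.1, mul_nonneg hb h2.1]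
        · nlinarith [mul_le_mul_of_nonneg_left h1.2 ha, mul_le_mul_of_nonneg_left h2.2 hb]
      · simp [hx' k hk, hy' k hk]
    refine convexHull_min ?_ hconv hx
    rintro y (hy | ⟨i, hi, rfl⟩)
    · exact ⟨(ih y hy).1, fun k hk => (ih y hy).2 k (by simp only [stageM] at hk; omega)⟩
    · obtain ⟨h1, h2⟩ := ih _ (hg n i hi)
      refine ⟨fun k => ?_, fun k hk => ?_⟩
      · by_cases h : k = stageM l n + i
        · subst h
          simp [h2 (stageM l n + i) (by omega), e]
        · simpa [e, Pi.single_apply, h] using h1 k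
      · have hne : k ≠ stageM l n + i := by simp only [stageM] at hk; omega
        have := h2 k (by simp only [stageM] at hk; omega)
        simp [e, hne, this]

theorem Construction.K0_le (A : Construction) {x : C0} (hx : x ∈ A.K0) (k : ℕ) :
    0 ≤ x k ∧ x k ≤ 1 := by
  have hc : Continuous fun y : C0 => y k := by
    refine (LipschitzWith.of_dist_le_mul (K := 1) fun y z => ?_).continuous
    rw [NNReal.coe_one, one_mul, ← ZeroAtInftyContinuousMap.dist_toBCF_eq_dist]
    exact BoundedContinuousFunction.dist_coe_le_dist (f := y.toBCF) (g := z.toBCF) k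
  have hcl : IsClosed {y : C0 | 0 ≤ y k ∧ y k ≤ 1} :=
    (isClosed_le continuous_const hc).inter (isClosed_le hc continuous_const)
  refine closure_minimal (fun y hy => ?_) hcl hx
  obtain ⟨n, hn⟩ := Set.mem_iUnion.1 hy
  exact (stageK_le A.l A.g A.g_mem n y hn).1 k

/-! ### The copy of `c₀` in `C[0,1]` -/

/-- The real Banach space `C[0,1]` with the supremum norm. -/
abbrev CI : Type := C(unitInterval, ℝ)

/-- Pairwise disjoint open subsets `V n` of `[0,1]` which do not contain `0`, and norm-one
functions `0 ≤ h n ≤ 1`, each vanishing outside `V n`. -/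
structure Bumps where
  V : ℕ → Set unitInterval
  V_open : ∀ n, IsOpen (V n)
  V_disjoint : Pairwise fun i j => Disjoint (V i) (V j)
  V_zero : ∀ n, (0 : unitInterval) ∉ V n
  h : ℕ → CI
  h_nonneg : ∀ n t, 0 ≤ h n t
  h_le_one : ∀ n t, h n t ≤ 1
  h_norm : ∀ n, ‖h n‖ = 1
  h_support : ∀ n, Function.support (h n) ⊆ V n

namespace Bumps

theorem exists_idx (b : Bumps) (t : unitInterval) : ∃ n, ∀ k, k ≠ n → b.h k t = 0 := by
  by_cases H : ∃ n, b.h n t ≠ 0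
  · obtain ⟨n, hn⟩ := H
    refine ⟨n, fun k hk => ?_⟩
    by_contra hk0
    exact Set.disjoint_left.1 (b.V_disjoint hk) (b.h_support k hk0) (b.h_support n hn)
  · push Not at H
    exact ⟨0, fun k _ => H k⟩

theorem summable (b : Bumps) (x : C0) : Summable fun n => x n • b.h n := by
  rw [summable_iff_vanishing_norm]
  intro r hr
  have hx : Tendsto (fun n => x n) atTop (𝓝 0) := by
    have := x.zero_at_infty'
    rwa [cocompact_eq_cofinite, Nat.cofinite_eq_atTop] at this
  obtain ⟨N, hN⟩ := eventually_atTop.1 (Metric.tendsto_nhds.1 hx (r / 2) (half_pos hr))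
  refine ⟨Finset.range N, fun s hs => ?_⟩
  refine lt_of_le_of_lt ?_ (half_lt_self hr)
  rw [ContinuousMap.norm_le _ (half_pos hr).le]
  intro t
  obtain ⟨n, hn⟩ := b.exists_idx t
  rw [ContinuousMap.sum_apply]
  simp only [ContinuousMap.smul_apply, smul_eq_mul]
  by_cases hns : n ∈ s
  · rw [Finset.sum_eq_single n (fun k _ hk => by rw [hn k hk, mul_zero])
      (fun h => absurd hns h), norm_mul]
    have h1 : N ≤ n := by
      by_contra hlt
      exact Finset.disjoint_left.1 hs hns (Finset.mem_range.2 (not_le.1 hlt))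
    have h2 : ‖x n‖ < r / 2 := by simpa using hN n h1
    have h3 : ‖b.h n t‖ ≤ 1 := by
      rw [Real.norm_of_nonneg (b.h_nonneg n t)]; exact b.h_le_one n t
    nlinarith [norm_nonneg (x n), norm_nonneg (b.h n t)]
  · rw [Finset.sum_eq_zero, norm_zero]
    · exact (half_pos hr).le
    · intro k hk
      rw [hn k (fun h => hns (h ▸ hk)), mul_zero]

/-- The linear map `c₀ → C[0,1]` with `e n ↦ h n`, that is, `x ↦ ∑ n, x n • h n`
(norm convergent). -/
def toFun (b : Bumps) : C0 →ₗ[ℝ] CI where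
  toFun x := ∑' n, x n • b.h n
  map_add' x y := by
    rw [← (b.summable x).tsum_add (b.summable y)]
    simp [add_smul]
  map_smul' c x := by
    rw [RingHom.id_apply, ← tsum_const_smul'']
    simp [mul_smul]

theorem toFun_apply (b : Bumps) (x : C0) {t : unitInterval} {n : ℕ}
    (hn : ∀ k, k ≠ n → b.h k t = 0) : b.toFun x t = x n * b.h n t := by
  have h1 : HasSum (fun k => (x k • b.h k) t) (b.toFun x t) :=
    ((b.summable x).hasSum.map (ContinuousMap.evalCLM ℝ t)
      (ContinuousMap.evalCLM ℝ t).continuous)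
  have h2 : HasSum (fun k => (x k • b.h k) t) (x n * b.h n t) := by
    have := hasSum_single (f := fun k => (x k • b.h k) t) n
      (fun k hk => by simp [hn k hk])
    simpa using this
  exact h1.unique h2

/-- The isometric embedding `c₀ → C[0,1]` with `e n ↦ h n`; its range is the closed linear span
of the functions `h n`. -/
def J (b : Bumps) : C0 →ₗᵢ[ℝ] CI where
  toLinearMap := b.toFun
  norm_map' x := by
    have hle : ∀ n, ‖x n‖ ≤ ‖x‖ := fun n => by
      rw [← ZeroAtInftyContinuousMap.norm_toBCF_eq_norm]
      exact x.toBCF.norm_coe_le_norm n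
    refine le_antisymm ?_ ?_
    · rw [ContinuousMap.norm_le _ (norm_nonneg x)]
      intro t
      obtain ⟨n, hn⟩ := b.exists_idx t
      rw [b.toFun_apply x hn, norm_mul, Real.norm_of_nonneg (b.h_nonneg n t)]
      nlinarith [hle n, norm_nonneg (x n), b.h_nonneg n t, b.h_le_one n t]
    · rw [← ZeroAtInftyContinuousMap.norm_toBCF_eq_norm,
        BoundedContinuousFunction.norm_le (norm_nonneg _)]
      intro n
      obtain ⟨t, ht⟩ : ∃ t, b.h n t = 1 := by
        obtain ⟨t, -, ht⟩ := isCompact_univ.exists_isMaxOn Set.univ_nonempty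
          (b.h n).continuous.continuousOn
        refine ⟨t, le_antisymm (b.h_le_one n t) ?_⟩
        rw [← b.h_norm n, ContinuousMap.norm_le _ (b.h_nonneg n t)]
        intro s
        rw [Real.norm_of_nonneg (b.h_nonneg n s)]
        exact ht (Set.mem_univ s)
      have hn : ∀ k, k ≠ n → b.h k t = 0 := by
        intro k hk
        by_contra hk0
        exact Set.disjoint_left.1 (b.V_disjoint hk) (b.h_support k hk0)
          (b.h_support n (by simp [ht]))
      have h1 := (b.toFun x).norm_coe_le_norm t
      rw [b.toFun_apply x hn, ht, mul_one] at h1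
      exact h1

theorem J_e (b : Bumps) (n : ℕ) : b.J (e n) = b.h n := by
  have h : HasSum (fun k => e n k • b.h k) (e n n • b.h n) :=
    hasSum_single n fun k hk => by simp [e, hk]
  have h2 : e n n = 1 := by simp [e]
  rw [h2, one_smul] at h
  exact h.tsum_eq

end Bumps

/-! ### The renorming of `C[0,1]` -/

/-- The set `K₀` in `C[0,1]`. -/
def K0 (A : Construction) (b : Bumps) : Set CI := b.J '' A.K0

/-- The set `2 (K₀ - 𝟙/2)` in `C[0,1]`. -/
def centred (A : Construction) (b : Bumps) : Set CI :=
  (fun a => (2 : ℝ) • (a - (1 / 2 : ℝ) • (1 : CI))) '' K0 A b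

/-- The set `(1 - ε) B_{C[0,1]} + ε B_{ker δ₀}`. -/
def thickBall (ε : ℝ) : Set CI :=
  {z | ∃ f k : CI, ‖f‖ ≤ 1 ∧ ‖k‖ ≤ 1 ∧ k 0 = 0 ∧ z = (1 - ε) • f + ε • k}

/-- The set `B_ε`, the closed convex hull of `2 (K₀ - 𝟙/2)`, `2 (-K₀ + 𝟙/2)` and
`(1 - ε) B_{C[0,1]} + ε B_{ker δ₀}`. -/
def newBall (A : Construction) (b : Bumps) (ε : ℝ) : Set CI :=
  closedConvexHull ℝ
    (centred A b ∪ (fun a => (2 : ℝ) • (-a + (1 / 2 : ℝ) • (1 : CI))) '' K0 A b ∪ thickBall ε)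

/-- The vector space `C[0,1]`, to be given the norm with unit ball `B_ε`, for `0 < ε < 1`. -/
def Renormed (_A : Construction) (_b : Bumps) (_ε : Set.Ioo (0 : ℝ) 1) : Type := CI

instance (A : Construction) (b : Bumps) (ε : Set.Ioo (0 : ℝ) 1) :
    AddCommGroup (Renormed A b ε) := inferInstanceAs (AddCommGroup CI)

instance (A : Construction) (b : Bumps) (ε : Set.Ioo (0 : ℝ) 1) :
    Module ℝ (Renormed A b ε) := inferInstanceAs (Module ℝ CI)

/-- The identity map from `C[0,1]` to the renormed space. -/
def toRenormed (A : Construction) (b : Bumps) (ε : Set.Ioo (0 : ℝ) 1) :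
    CI ≃ₗ[ℝ] Renormed A b ε := LinearEquiv.refl ℝ CI

section NewBall

variable (A : Construction) (b : Bumps)

theorem K0_le {f : CI} (hf : f ∈ K0 A b) (t : unitInterval) : 0 ≤ f t ∧ f t ≤ 1 := by
  obtain ⟨x, hx, rfl⟩ := hf
  obtain ⟨n, hn⟩ := b.exists_idx t
  have h1 : b.J x t = x n * b.h n t := b.toFun_apply x hn
  have h2 := A.K0_le hx n
  have h3 := b.h_nonneg n t
  have h4 := b.h_le_one n t
  rw [h1]
  constructor <;> nlinarith

theorem convex_newBall (ε : ℝ) : Convex ℝ (newBall A b ε) := convex_closedConvexHull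

theorem isClosed_newBall (ε : ℝ) : IsClosed (newBall A b ε) := isClosed_closedConvexHull

theorem newBall_neg (ε : ℝ) {x : CI} (hx : x ∈ newBall A b ε) : -x ∈ newBall A b ε := by
  have h : newBall A b ε ⊆ (fun y : CI => -y) ⁻¹' newBall A b ε := by
    refine closedConvexHull_min ?_ ?_ (isClosed_closedConvexHull.preimage continuous_neg)
    · rintro y ((⟨a, ha, rfl⟩ | ⟨a, ha, rfl⟩) | ⟨f, k, hf, hk, hk0, rfl⟩)
      · refine subset_closedConvexHull (Or.inl (Or.inr ⟨a, ha, ?_⟩))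
        module
      · refine subset_closedConvexHull (Or.inl (Or.inl ⟨a, ha, ?_⟩))
        module
      · refine subset_closedConvexHull (Or.inr ⟨-f, -k, ?_, ?_, ?_, ?_⟩)
        · rwa [norm_neg]
        · rwa [norm_neg]
        · simp [hk0]
        · module
    · exact (convex_newBall A b ε).is_linear_preimage (LinearMap.isLinear (-LinearMap.id))
  exact h hx

theorem newBall_subset {ε : ℝ} (hε : ε ∈ Set.Ioo (0 : ℝ) 1) :
    newBall A b ε ⊆ Metric.closedBall 0 1 := by
  refine closedConvexHull_min ?_ (convex_closedBall _ _) Metric.isClosed_closedBall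
  have key : ∀ a ∈ K0 A b, ‖(2 : ℝ) • (a - (1 / 2 : ℝ) • (1 : CI))‖ ≤ 1 := by
    intro a ha
    rw [ContinuousMap.norm_le _ zero_le_one]
    intro t
    obtain ⟨h1, h2⟩ := K0_le A b ha t
    simp only [ContinuousMap.smul_apply, ContinuousMap.sub_apply, ContinuousMap.one_apply,
      smul_eq_mul, Real.norm_eq_abs, abs_le]
    constructor <;> linarith
  rintro y ((⟨a, ha, rfl⟩ | ⟨a, ha, rfl⟩) | ⟨f, k, hf, hk, hk0, rfl⟩)
  · simpa using key a ha
  · have : (2 : ℝ) • (-a + (1 / 2 : ℝ) • (1 : CI)) = -((2 : ℝ) • (a - (1 / 2 : ℝ) • (1 : CI))) := by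
      module
    simp only [mem_closedBall_zero_iff, this, norm_neg]
    exact key a ha
  · rw [mem_closedBall_zero_iff]
    calc ‖(1 - ε) • f + ε • k‖ ≤ ‖(1 - ε) • f‖ + ‖ε • k‖ := norm_add_le _ _
      _ = (1 - ε) * ‖f‖ + ε * ‖k‖ := by
        rw [norm_smul, norm_smul, Real.norm_of_nonneg (sub_nonneg.2 hε.2.le),
          Real.norm_of_nonneg hε.1.le]
      _ ≤ 1 := by nlinarith [hε.1, hε.2]

theorem closedBall_subset_newBall {ε : ℝ} (hε : ε ∈ Set.Ioo (0 : ℝ) 1) :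
    Metric.closedBall 0 (1 - ε) ⊆ newBall A b ε := by
  intro y hy
  rw [mem_closedBall_zero_iff] at hy
  have h1 : 0 < 1 - ε := sub_pos.2 hε.2
  refine subset_closedConvexHull (Or.inr ⟨(1 - ε)⁻¹ • y, 0, ?_, by simp, by simp, ?_⟩)
  · rw [norm_smul, norm_inv, Real.norm_of_nonneg h1.le, inv_mul_le_iff₀ h1]
    simpa using hy
  · rw [smul_inv_smul₀ h1.ne', smul_zero, add_zero]

theorem newBall_mem_nhds {ε : ℝ} (hε : ε ∈ Set.Ioo (0 : ℝ) 1) : newBall A b ε ∈ 𝓝 (0 : CI) :=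
  Filter.mem_of_superset (Metric.closedBall_mem_nhds 0 (sub_pos.2 hε.2))
    (closedBall_subset_newBall A b hε)

end NewBall

/-- The norm with unit ball `B_ε`: the Minkowski functional of `B_ε`. -/
instance (A : Construction) (b : Bumps) (ε : Set.Ioo (0 : ℝ) 1) : Norm (Renormed A b ε) where
  norm x := gauge (newBall A b ε) ((toRenormed A b ε).symm x)

theorem normCore (A : Construction) (b : Bumps) (ε : Set.Ioo (0 : ℝ) 1) :
    NormedSpace.Core ℝ (Renormed A b ε) where
  norm_nonneg _ := gauge_nonneg _
  norm_smul c x := by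
    have hab := absorbent_nhds_zero (𝕜 := ℝ) (newBall_mem_nhds A b ε.2)
    have h := (gaugeSeminorm (𝕜 := ℝ) (s := newBall A b ε)
      ((balanced_iff_neg_mem (convex_newBall A b ε)).2 fun _ h => newBall_neg A b ε h)
      (convex_newBall A b ε) hab).smul' c ((toRenormed A b ε).symm x)
    exact h
  norm_triangle x y :=
    gauge_add_le (convex_newBall A b ε) (absorbent_nhds_zero (newBall_mem_nhds A b ε.2))
      ((toRenormed A b ε).symm x) ((toRenormed A b ε).symm y)
  norm_eq_zero_iff x :=
    (gauge_eq_zero (absorbent_nhds_zero (newBall_mem_nhds A b ε.2))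
      (NormedSpace.isVonNBounded_of_isBounded ℝ
        (Metric.isBounded_closedBall.subset (newBall_subset A b ε.2)))).trans
      (toRenormed A b ε).symm.map_eq_zero_iff

instance (A : Construction) (b : Bumps) (ε : Set.Ioo (0 : ℝ) 1) :
    NormedAddCommGroup (Renormed A b ε) := NormedAddCommGroup.ofCore (normCore A b ε)

instance (A : Construction) (b : Bumps) (ε : Set.Ioo (0 : ℝ) 1) :
    NormedSpace ℝ (Renormed A b ε) := NormedSpace.ofCore (normCore A b ε)

/-- `B_ε` is the closed unit ball of the new norm. -/
theorem closedBall_renormed (A : Construction) (b : Bumps) (ε : Set.Ioo (0 : ℝ) 1) :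
    Metric.closedBall (0 : Renormed A b ε) 1 = toRenormed A b ε '' newBall A b ε := by
  ext x
  rw [mem_closedBall_zero_iff]
  have h : ‖x‖ ≤ 1 ↔ (toRenormed A b ε).symm x ∈ newBall A b ε := by
    have := gauge_le_one_iff_mem_closure (x := (toRenormed A b ε).symm x)
      (convex_newBall A b ε) (newBall_mem_nhds A b ε.2)
    rw [(isClosed_newBall A b ε).closure_eq] at this
    exact this
  rw [h]
  constructor
  · exact fun hx => ⟨_, hx, (toRenormed A b ε).apply_symm_apply x⟩
  · rintro ⟨y, hy, rfl⟩
    simpa using hy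

end AOR

end

open Filter Topology

namespace AOR

/-! ### Coordinates of the elements of `K₀ ⊂ c₀` -/

/-! Both halves rest on the tree structure of `K₀`: once chosen, a point `g j` receives at every
stage a successor `g j + e k` with a fresh coordinate `k`.

Super Daugavet points. Disjoint bumps are weakly null, so `2 J (g j) - 1` is a weak limit of points
`2 J (g j + e k) - 1` of `B_ε`, which have the value `1` at the peak of `h k`. The remaining
generators of `B_ε` can also be moved weakly to values near `1` at far peaks
(`exists_perturbation`). Hence every non-empty relatively weakly open part of the ball contains
elements that are almost `1` at some far peak, where a given `2 J a - 1` is almost `-1`, because `a`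
is in `c₀`. The sup norm is at most the new norm, so the distance `2` is approached.

Small combinations of slices. The functional `z (peak (m r)) - z 0` has supremum `2` on `B_ε`. It is
at most `2 - ε` on the thick ball, thanks to the summand in `ker δ₀`, and at most `0` on `1 - 2 K₀`.
A near-maximizer is therefore governed by elements `a` of `K₀` with `a (m r)` near `1`, and these
live, up to a small error, on coordinate `0` and on the branch through `e 0 + e (m r)`
(`abs_sub_mul_le_of_vertex`). Different `r` give different branches (`sum_stageM_le_one`), so
averaging near-maximizers for `N` values of `r` leaves an error of order `1 / N` around `2 J (e 0) -
1`, plus a multiple of the slice width (`norm_average_sub_le`). -/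

theorem continuous_coord (k : ℕ) : Continuous fun y : C0 => y k := by
  refine (LipschitzWith.of_dist_le_mul (K := 1) fun y z => ?_).continuous
  rw [NNReal.coe_one, one_mul, ← ZeroAtInftyContinuousMap.dist_toBCF_eq_dist]
  exact BoundedContinuousFunction.dist_coe_le_dist (f := y.toBCF) (g := z.toBCF) k

theorem tendsto_coord (x : C0) : Tendsto (fun k => x k) atTop (𝓝 0) := by
  have := x.zero_at_infty'
  rwa [cocompact_eq_cofinite, Nat.cofinite_eq_atTop] at this

theorem e_self (k : ℕ) : e k k = 1 := by simp [e]

theorem e_ne {k j : ℕ} (h : j ≠ k) : e k j = 0 := by simp [e, h]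

namespace Construction

variable (A : Construction)

theorem l_pos (n : ℕ) : 0 < A.l n :=
  lt_of_lt_of_le (by rw [A.l_zero]; exact one_pos) (A.l_mono (Nat.zero_le n))

theorem stageM_strictMono : StrictMono (stageM A.l) :=
  strictMono_nat_of_lt_succ fun n => Nat.lt_add_of_pos_right (A.l_pos n)

theorem stageM_pos (n : ℕ) : 0 < stageM A.l n :=
  lt_of_lt_of_le one_pos (A.stageM_strictMono.monotone (Nat.zero_le n))

/-- A new coordinate of one stage is the first new coordinate of some stage only if both stages
agree. -/
theorem eq_of_stageM_add_eq {n j r : ℕ} (hj : j < A.l n)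
    (h : stageM A.l n + j = stageM A.l r) : n = r ∧ j = 0 := by
  have h1 : n ≤ r := A.stageM_strictMono.le_iff_le.1 (by omega)
  have h2 : r < n + 1 := A.stageM_strictMono.lt_iff_lt.1 (by
    simp only [stageM]; omega)
  obtain rfl : n = r := by omega
  exact ⟨rfl, by omega⟩

theorem convex_stageK (n : ℕ) : Convex ℝ (stageK A.l A.g n) := by
  cases n with
  | zero => exact convex_singleton _
  | succ n => exact convex_convexHull ℝ _

theorem monotone_stageK : Monotone (stageK A.l A.g) :=
  monotone_nat_of_le_succ fun _ _ hx => subset_convexHull ℝ _ (Or.inl hx)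

theorem stageK_subset_K0 (n : ℕ) : stageK A.l A.g n ⊆ A.K0 :=
  (Set.subset_iUnion _ n).trans subset_closure

theorem convex_K0 : Convex ℝ A.K0 :=
  (A.monotone_stageK.directed_le.convex_iUnion fun {n} => A.convex_stageK n).closure

theorem e_zero_mem : e 0 ∈ A.K0 := A.stageK_subset_K0 0 rfl

theorem vertex_mem {n j : ℕ} (hj : j < A.l n) : A.g j + e (stageM A.l n + j) ∈ A.K0 :=
  A.stageK_subset_K0 (n + 1) (subset_convexHull ℝ _ (Or.inr ⟨j, hj, rfl⟩))

/-- The root `g 0 = e 0` belongs to every net, so it has a successor at every stage; these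
infinitely many branches are what the slices separate. -/
theorem e_zero_add_mem (r : ℕ) : e 0 + e (stageM A.l r) ∈ A.K0 := by
  simpa [A.g_zero] using A.vertex_mem (A.l_pos r)

theorem g_apply_new {n j : ℕ} (hj : j < A.l n) {k : ℕ} (hk : stageM A.l n ≤ k) : A.g j k = 0 :=
  (stageK_le A.l A.g A.g_mem n _ (A.g_mem n j hj)).2 k hk

/-- A closed convex property which holds for `e 0` and passes from `g j` to the vertices
`g j + e (m n + j)` holds on `K₀`. -/
theorem K0_induction {P : Set C0} (hconv : Convex ℝ P) (hcl : IsClosed P) (h0 : e 0 ∈ P)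
    (hs : ∀ n, ∀ j < A.l n, A.g j ∈ P → A.g j + e (stageM A.l n + j) ∈ P) : A.K0 ⊆ P := by
  refine closure_minimal (Set.iUnion_subset fun n => ?_) hcl
  induction n with
  | zero => rintro x rfl; exact h0
  | succ n ih =>
    refine convexHull_min ?_ hconv
    rintro x (hx | ⟨j, hj, rfl⟩)
    · exact ih hx
    · exact hs n j hj (ih (A.g_mem n j hj))

/-- A vertex acquires a coordinate `m r` only as a successor of `g 0 = e 0`, whose coordinates `m r`
all vanish. Any other vertex inherits the sum from its predecessor. -/
theorem sum_stageM_le_one (N : ℕ) {a : C0} (ha : a ∈ A.K0) :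
    ∑ r ∈ Finset.range N, a (stageM A.l r) ≤ 1 := by
  refine A.K0_induction (P := {a | ∑ r ∈ Finset.range N, a (stageM A.l r) ≤ 1}) ?_ ?_ ?_ ?_ ha
  · intro x hx y hy s t hs ht hst
    simp only [Set.mem_ofPred_eq, ZeroAtInftyContinuousMap.add_apply,
      ZeroAtInftyContinuousMap.smul_apply, smul_eq_mul, Finset.sum_add_distrib,
      ← Finset.mul_sum] at *
    nlinarith
  · exact isClosed_le (continuous_finsetSum _ fun r _ => continuous_coord _) continuous_const
  · rw [Set.mem_ofPred_eq, Finset.sum_eq_zero fun r _ => e_ne (A.stageM_pos r).ne']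
    exact zero_le_one
  · intro n j hj hg
    simp only [Set.mem_ofPred_eq, ZeroAtInftyContinuousMap.add_apply] at *
    by_cases h : ∃ r, stageM A.l n + j = stageM A.l r
    · obtain ⟨r, hr⟩ := h
      obtain ⟨rfl, rfl⟩ := A.eq_of_stageM_add_eq hj hr
      have : ∀ r ∈ Finset.range N, A.g 0 (stageM A.l r) + e (stageM A.l n + 0) (stageM A.l r)
          = if n = r then 1 else 0 := by
        intro r _
        rw [A.g_zero, e_ne (A.stageM_pos r).ne', zero_add]
        split_ifs with hnr
        · subst hnr; exact e_self _
        · exact e_ne fun h' => hnr (A.stageM_strictMono.injective h').symm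
      rw [Finset.sum_congr rfl this, Finset.sum_ite_eq]
      split_ifs <;> norm_num
    · have : ∀ r ∈ Finset.range N, A.g j (stageM A.l r) + e (stageM A.l n + j) (stageM A.l r)
          = A.g j (stageM A.l r) := by
        intro r _
        rw [e_ne fun h' => h ⟨r, h'.symm⟩, add_zero]
      rwa [Finset.sum_congr rfl this]

/-- The condition is convex and closed in `a`, so it is checked along the tree. If the fresh
coordinate is `m r`, the vertex is `e 0 + e (m r)` and both sides vanish. If it is `k`, the vertex
is `v` itself and equality holds. Otherwise neither coordinate changes and the bound is inherited.
Stating `hvk` as an implication also covers `k = 0`, which no vertex introduces. -/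
theorem abs_sub_mul_le_of_vertex (k r : ℕ) {v : C0} (hv : ∀ j, 0 ≤ v j ∧ v j ≤ 1)
    (hvk : ∀ n, ∀ j < A.l n, stageM A.l n + j = k → v = A.g j + e k) {a : C0} (ha : a ∈ A.K0) :
    |a k - e 0 k| * (1 - v (stageM A.l r)) ≤ 1 - a (stageM A.l r) := by
  have hv1 := hv (stageM A.l r)
  refine A.K0_induction (P := {a | |a k - e 0 k| * (1 - v (stageM A.l r)) ≤
    1 - a (stageM A.l r)}) ?_ ?_ ?_ ?_ ha
  · intro x hx y hy s t hs ht hst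
    simp only [Set.mem_ofPred_eq, ZeroAtInftyContinuousMap.add_apply,
      ZeroAtInftyContinuousMap.smul_apply, smul_eq_mul] at *
    have h1 : |s * x k + t * y k - e 0 k| ≤ s * |x k - e 0 k| + t * |y k - e 0 k| := by
      have : s * x k + t * y k - e 0 k = s * (x k - e 0 k) + t * (y k - e 0 k) := by
        linear_combination (e 0 k) * hst
      rw [this]
      refine (abs_add_le _ _).trans_eq ?_
      rw [abs_mul, abs_mul, abs_of_nonneg hs, abs_of_nonneg ht]
    have h2 := mul_le_mul_of_nonneg_right h1 (sub_nonneg.2 hv1.2)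
    have h3 := mul_le_mul_of_nonneg_left hx hs
    have h4 := mul_le_mul_of_nonneg_left hy ht
    linarith
  · exact isClosed_le ((((continuous_coord k).sub continuous_const).abs).mul continuous_const)
      (continuous_const.sub (continuous_coord _))
  · simp [e_ne (A.stageM_pos r).ne']
  · intro n j hj hg
    simp only [Set.mem_ofPred_eq, ZeroAtInftyContinuousMap.add_apply] at *
    by_cases hr : stageM A.l n + j = stageM A.l r
    · obtain ⟨rfl, rfl⟩ := A.eq_of_stageM_add_eq hj hr
      rw [add_zero] at *
      rw [A.g_zero, e_ne (A.stageM_pos n).ne', e_self]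
      by_cases hk : stageM A.l n = k
      · subst hk
        rw [hvk n 0 hj (add_zero _)]
        simp [A.g_zero, e_self, e_ne (A.stageM_pos n).ne']
      · simp [e_ne (Ne.symm hk)]
    · rw [e_ne (Ne.symm hr), add_zero]
      by_cases hk : stageM A.l n + j = k
      · rw [hvk n j hj hk, hk, e_self, A.g_apply_new hj (by omega : stageM A.l n ≤ k),
          ZeroAtInftyContinuousMap.add_apply, ← hk, e_ne (Ne.symm hr),
          e_ne (by have := A.stageM_pos n; omega)]
        simp
      · rwa [e_ne (Ne.symm hk), add_zero]

/-- The witness is the vertex that introduces coordinate `k`, or `e 0` if there is none. It does not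
depend on `r`, so the weights `v (m r)` of a fixed `k` can be summed over `r`. -/
theorem exists_abs_sub_mul_le (k : ℕ) : ∃ v ∈ A.K0, ∀ r, ∀ a ∈ A.K0,
    |a k - e 0 k| * (1 - v (stageM A.l r)) ≤ 1 - a (stageM A.l r) := by
  by_cases h : ∃ n, ∃ j < A.l n, stageM A.l n + j = k
  · obtain ⟨n, j, hj, rfl⟩ := h
    refine ⟨_, A.vertex_mem hj, fun r a ha =>
      A.abs_sub_mul_le_of_vertex _ r (A.K0_le (A.vertex_mem hj)) ?_ ha⟩
    -- The blocks of fresh coordinates of distinct stages are disjoint, so `k` determines its stage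
    -- and its index.
    intro n' j' hj' h
    have h1 : n' < n + 1 := A.stageM_strictMono.lt_iff_lt.1 (by simp only [stageM]; omega)
    have h2 : n < n' + 1 := A.stageM_strictMono.lt_iff_lt.1 (by simp only [stageM]; omega)
    obtain rfl : n = n' := by omega
    obtain rfl : j = j' := by omega
    rfl
  · exact ⟨_, A.e_zero_mem, fun r a ha => A.abs_sub_mul_le_of_vertex _ r (A.K0_le A.e_zero_mem)
      (fun n j hj hk => absurd ⟨n, j, hj, hk⟩ h) ha⟩

end Construction

/-! ### Values of the embedded functions at `0` and at the peaks -/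

theorem Bumps.J_apply (b : Bumps) (x : C0) {t : unitInterval} {n : ℕ}
    (hn : ∀ k, k ≠ n → b.h k t = 0) : b.J x t = x n * b.h n t := b.toFun_apply x hn

theorem Bumps.h_zero (b : Bumps) (n : ℕ) : b.h n 0 = 0 := by
  by_contra h
  exact b.V_zero n (b.h_support n h)

theorem Bumps.J_zero (b : Bumps) (x : C0) : b.J x 0 = 0 := by
  rw [b.J_apply x (n := 0) fun k _ => b.h_zero k, b.h_zero, mul_zero]

theorem Bumps.exists_peak (b : Bumps) (n : ℕ) :
    ∃ t, b.h n t = 1 ∧ ∀ k, k ≠ n → b.h k t = 0 := by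
  obtain ⟨t, -, ht⟩ := isCompact_univ.exists_isMaxOn Set.univ_nonempty
    (b.h n).continuous.continuousOn
  have h1 : b.h n t = 1 := by
    refine le_antisymm (b.h_le_one n t) ?_
    rw [← b.h_norm n, ContinuousMap.norm_le _ (b.h_nonneg n t)]
    intro s
    rw [Real.norm_of_nonneg (b.h_nonneg n s)]
    exact ht (Set.mem_univ s)
  refine ⟨t, h1, fun k hk => ?_⟩
  by_contra hk0
  exact Set.disjoint_left.1 (b.V_disjoint hk) (b.h_support k hk0) (b.h_support n (by simp [h1]))

/-- A point at which `h n` attains its norm. -/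
noncomputable def Bumps.peak (b : Bumps) (n : ℕ) : unitInterval := (b.exists_peak n).choose

theorem Bumps.h_peak (b : Bumps) (n : ℕ) : b.h n (b.peak n) = 1 :=
  (b.exists_peak n).choose_spec.1

theorem Bumps.J_peak (b : Bumps) (x : C0) (n : ℕ) : b.J x (b.peak n) = x n := by
  rw [b.J_apply x (n := n) (t := b.peak n) (b.exists_peak n).choose_spec.2, b.h_peak, mul_one]


/-! ### The ball `B_ε` -/

section Ball

variable (A : Construction) (b : Bumps) (ε : Set.Ioo (0 : ℝ) 1)

theorem newBall_abs_le {z : CI} (hz : z ∈ newBall A b ε) (t : unitInterval) : |z t| ≤ 1 := by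
  have h := newBall_subset A b ε.2 hz
  rw [mem_closedBall_zero_iff] at h
  exact (z.norm_coe_le_norm t).trans h

theorem mem_centred {x : CI} : x ∈ centred A b ↔ ∃ a ∈ A.K0, x = (2 : ℝ) • b.J a - 1 := by
  have h : ∀ a : CI, (2 : ℝ) • (a - (1 / 2 : ℝ) • (1 : CI)) = (2 : ℝ) • a - 1 := fun a => by
    module
  simp only [centred, K0, Set.mem_image, h]
  constructor
  · rintro ⟨_, ⟨a, ha, rfl⟩, rfl⟩
    exact ⟨a, ha, rfl⟩
  · rintro ⟨a, ha, rfl⟩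
    exact ⟨_, ⟨a, ha, rfl⟩, rfl⟩

theorem centred_subset_newBall : centred A b ⊆ newBall A b ε := fun _ hx =>
  subset_closedConvexHull (Or.inl (Or.inl hx))

theorem convex_centred : Convex ℝ (centred A b) := by
  intro x hx y hy s t hs ht hst
  rw [mem_centred] at *
  obtain ⟨a, ha, rfl⟩ := hx
  obtain ⟨c, hc, rfl⟩ := hy
  refine ⟨_, A.convex_K0 ha hc hs ht hst, ?_⟩
  obtain rfl : t = 1 - s := by linarith
  rw [map_add, map_smul, map_smul]
  module

theorem newBall_induction {P : Set CI} (hconv : Convex ℝ P) (hcl : IsClosed P)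
    (h1 : ∀ a ∈ A.K0, (2 : ℝ) • b.J a - 1 ∈ P) (h2 : ∀ a ∈ A.K0, 1 - (2 : ℝ) • b.J a ∈ P)
    (h3 : ∀ z ∈ thickBall ε, z ∈ P) : newBall A b ε ⊆ P := by
  refine closedConvexHull_min ?_ hconv hcl
  rintro y ((hy | ⟨_, ⟨a, ha, rfl⟩, rfl⟩) | hy)
  · obtain ⟨a, ha, rfl⟩ := (mem_centred A b).1 hy
    exact h1 a ha
  · convert h2 a ha using 1
    dsimp only
    module
  · exact h3 y hy

/-- If `z ∈ B_ε` nearly maximizes `z (peak (m r)) - z 0`, then `z` is close to `2 (e 0 - 𝟙/2)`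
at every point `t` at which the weight `c r` is not large; the weights of a point sum up to at
most `1`. -/
theorem newBall_close (t : unitInterval) : ∃ c : ℕ → ℝ,
    (∀ r, 0 ≤ c r ∧ c r ≤ 1) ∧ (∀ N, ∑ r ∈ Finset.range N, c r ≤ 1) ∧
    ∀ r, ∀ z ∈ newBall A b ε, |z t - ((2 : ℝ) • b.J (e 0) - 1 : CI) t| * (1 - c r) ≤
      2 / ε * (2 + z 0 - z (b.peak (stageM A.l r))) := by
  -- At `t` only the bump `k` can be nonzero, so `2 J a - 1` depends there on the coordinate `a k`
  -- alone.
  obtain ⟨k, hk⟩ := b.exists_idx t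
  obtain ⟨v, hv, hvk⟩ := A.exists_abs_sub_mul_le k
  have hc : ∀ r, 0 ≤ v (stageM A.l r) ∧ v (stageM A.l r) ≤ 1 := fun r => A.K0_le hv _
  refine ⟨fun r => v (stageM A.l r), hc, fun N => A.sum_stageM_le_one N hv, fun r => ?_⟩
  have hε0 : (0 : ℝ) < ε := ε.2.1
  have hε1 : (ε : ℝ) < 1 := ε.2.2
  have h2ε : 2 ≤ 2 / (ε : ℝ) := by rw [le_div_iff₀ hε0]; linarith
  set base : CI := (2 : ℝ) • b.J (e 0) - 1 with hbase
  have hbase_mem : base ∈ newBall A b ε :=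
    centred_subset_newBall A b ε ((mem_centred A b).2 ⟨_, A.e_zero_mem, rfl⟩)
  have hb1 := newBall_abs_le A b ε hbase_mem t
  have hc0 := (hc r).1
  have hc1 := (hc r).2
  set c := v (stageM A.l r) with hcdef
  -- This bound suffices for generators on which the functional stays at least `ε` below `2`: the
  -- right-hand side is then at least `2 / ε * ε = 2`.
  have crude : ∀ z ∈ newBall A b ε, |z t - base t| * (1 - c) ≤ 2 := by
    intro z hz
    have h1 := newBall_abs_le A b ε hz t
    have h2 : |z t - base t| ≤ 2 := (abs_sub _ _).trans (by linarith)
    nlinarith [abs_nonneg (z t - base t)]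
  refine newBall_induction A b ε (P := {z | |z t - base t| * (1 - c) ≤
      2 / ε * (2 + z 0 - z (b.peak (stageM A.l r)))}) ?_ ?_ ?_ ?_ ?_
  · intro x hx y hy p q hp hq hpq
    simp only [Set.mem_ofPred_eq, ContinuousMap.add_apply, ContinuousMap.smul_apply,
      smul_eq_mul] at *
    have h1 : |p * x t + q * y t - base t| ≤ p * |x t - base t| + q * |y t - base t| := by
      have : p * x t + q * y t - base t = p * (x t - base t) + q * (y t - base t) := by
        linear_combination (base t) * hpq
      rw [this]
      refine (abs_add_le _ _).trans_eq ?_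
      rw [abs_mul, abs_mul, abs_of_nonneg hp, abs_of_nonneg hq]
    have h2 := mul_le_mul_of_nonneg_right h1 (sub_nonneg.2 hc1)
    have h3 := mul_le_mul_of_nonneg_left hx hp
    have h4 := mul_le_mul_of_nonneg_left hy hq
    have h5 : 2 / (ε : ℝ) * (2 + (p * x 0 + q * y 0) -
        (p * x (b.peak (stageM A.l r)) + q * y (b.peak (stageM A.l r)))) =
        p * (2 / ε * (2 + x 0 - x (b.peak (stageM A.l r)))) +
        q * (2 / ε * (2 + y 0 - y (b.peak (stageM A.l r)))) := by
      linear_combination (-(2 / (ε : ℝ) * 2)) * hpq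
    rw [h5]
    linarith
  · have hev : ∀ s, Continuous fun z : CI => z s := fun s => continuous_eval_const s
    exact isClosed_le ((((hev t).sub continuous_const).abs).mul continuous_const)
      (continuous_const.mul ((continuous_const.add (hev 0)).sub (hev _)))
  · intro a ha
    have h1 := hvk r a ha
    have h2 : |((2 : ℝ) • b.J a - 1 : CI) t - base t| ≤ 2 * |a k - e 0 k| := by
      have : ((2 : ℝ) • b.J a - 1 : CI) t - base t = 2 * (a k - e 0 k) * b.h k t := by
        simp [hbase, b.J_apply _ hk]
        ring
      rw [this, abs_mul, abs_mul, abs_of_nonneg (b.h_nonneg k t), abs_two]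
      exact mul_le_of_le_one_right (by positivity) (b.h_le_one k t)
    have h3 := A.K0_le ha (stageM A.l r)
    simp only [Set.mem_ofPred_eq]
    have h4 : 2 + ((2 : ℝ) • b.J a - 1 : CI) 0 - ((2 : ℝ) • b.J a - 1 : CI)
        (b.peak (stageM A.l r)) = 2 * (1 - a (stageM A.l r)) := by
      simp [b.J_zero, b.J_peak]
      ring
    rw [h4]
    nlinarith [mul_le_mul_of_nonneg_right h2 (sub_nonneg.2 hc1)]
  · intro a ha
    have h0 : 1 - (2 : ℝ) • b.J a ∈ newBall A b ε := by
      have := newBall_neg A b ε (centred_subset_newBall A b ε ((mem_centred A b).2 ⟨a, ha, rfl⟩))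
      simpa using this
    refine (crude _ h0).trans ?_
    have h3 := A.K0_le ha (stageM A.l r)
    have h4 : 2 + (1 - (2 : ℝ) • b.J a : CI) 0 - (1 - (2 : ℝ) • b.J a : CI)
        (b.peak (stageM A.l r)) = 2 + 2 * a (stageM A.l r) := by
      simp [b.J_zero, b.J_peak]
      ring
    rw [h4]
    nlinarith
  · intro z hz
    have h0 : z ∈ newBall A b ε := subset_closedConvexHull (Or.inr hz)
    refine (crude z h0).trans ?_
    have h1 := newBall_abs_le A b ε h0 (b.peak (stageM A.l r))
    -- The summand in `ker δ₀` contributes nothing at `0`; this is the source of the gap `ε`.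
    have h2 : -(1 - ε) ≤ z 0 := by
      obtain ⟨f, q, hf, -, hq, rfl⟩ := hz
      have := neg_le_of_abs_le ((f.norm_coe_le_norm 0).trans hf)
      simp only [ContinuousMap.add_apply, ContinuousMap.smul_apply, smul_eq_mul, hq]
      nlinarith
    have h3 : (ε : ℝ) ≤ 2 + z 0 - z (b.peak (stageM A.l r)) := by
      have := le_of_abs_le h1
      linarith
    calc (2 : ℝ) = 2 / ε * ε := by field_simp
      _ ≤ _ := mul_le_mul_of_nonneg_left h3 (by positivity)

/-! ### Comparison of the norms -/

theorem norm_toRenormed_le (x : CI) : ‖toRenormed A b ε x‖ ≤ ‖x‖ / (1 - ε) := by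
  have h1 : 0 < 1 - (ε : ℝ) := sub_pos.2 ε.2.2
  have h := gauge_mono (absorbent_nhds_zero (Metric.closedBall_mem_nhds 0 h1))
    (closedBall_subset_newBall A b ε.2) x
  rwa [gauge_closedBall h1.le] at h

theorem norm_le_norm_toRenormed (x : CI) : ‖x‖ ≤ ‖toRenormed A b ε x‖ := by
  have h := le_gauge_of_subset_closedBall (absorbent_nhds_zero (newBall_mem_nhds A b ε.2))
    zero_le_one (newBall_subset A b ε.2) (x := x)
  rwa [div_one] at h

theorem norm_toRenormed_le_one {x : CI} (hx : x ∈ newBall A b ε) : ‖toRenormed A b ε x‖ ≤ 1 := by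
  rw [← mem_closedBall_zero_iff, closedBall_renormed]
  exact ⟨x, hx, rfl⟩

/-- The identity map as an isomorphism of normed spaces. -/
noncomputable def renormEquiv : CI ≃L[ℝ] Renormed A b ε :=
  (toRenormed A b ε).toContinuousLinearEquivOfBounds (1 - ε)⁻¹ 1
    (fun x => by
      rw [inv_mul_eq_div]
      exact norm_toRenormed_le A b ε x)
    (fun x => by
      simpa using norm_le_norm_toRenormed A b ε ((toRenormed A b ε).symm x))

theorem completeSpace_renormed : CompleteSpace (Renormed A b ε) :=
  (completeSpace_congr (e := (renormEquiv A b ε).toEquiv)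
    (renormEquiv A b ε).isUniformEmbedding).1 inferInstance

/-! ### Small convex combinations of slices -/

/-- The functional `z ↦ z (peak (m r)) - z 0`. -/
noncomputable def sliceFunctional (r : ℕ) : Renormed A b ε →L[ℝ] ℝ :=
  ((ContinuousMap.evalCLM ℝ (b.peak (stageM A.l r)) : CI →L[ℝ] ℝ) -
    ContinuousMap.evalCLM ℝ (0 : unitInterval)).comp
    ((renormEquiv A b ε).symm : Renormed A b ε →L[ℝ] CI)

theorem sliceFunctional_apply (r : ℕ) (z : CI) :
    sliceFunctional A b ε r (toRenormed A b ε z) = z (b.peak (stageM A.l r)) - z 0 := rfl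

/-- The element `2 (e 0 + e (m r) - 𝟙/2)`. -/
noncomputable def slicePoint (r : ℕ) : CI := (2 : ℝ) • b.J (e 0 + e (stageM A.l r)) - 1

theorem slicePoint_mem (r : ℕ) : slicePoint A b r ∈ centred A b :=
  (mem_centred A b).2 ⟨_, A.e_zero_add_mem r, rfl⟩

theorem sliceFunctional_slicePoint (r : ℕ) :
    sliceFunctional A b ε r (toRenormed A b ε (slicePoint A b r)) = 2 := by
  rw [sliceFunctional_apply, slicePoint]
  simp only [ContinuousMap.sub_apply, ContinuousMap.smul_apply, b.J_peak, b.J_zero,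
    ZeroAtInftyContinuousMap.add_apply, e_self, e_ne (A.stageM_pos r).ne', smul_eq_mul,
    ContinuousMap.one_apply]
  norm_num

theorem sSup_sliceFunctional (r : ℕ) :
    sSup (sliceFunctional A b ε r '' (toRenormed A b ε '' newBall A b ε)) = 2 := by
  refine IsGreatest.csSup_eq ⟨⟨_, ⟨_, centred_subset_newBall A b ε (slicePoint_mem A b r), rfl⟩,
    sliceFunctional_slicePoint A b ε r⟩, ?_⟩
  rintro _ ⟨_, ⟨z, hz, rfl⟩, rfl⟩
  rw [sliceFunctional_apply]
  have h1 := le_of_abs_le (newBall_abs_le A b ε hz (b.peak (stageM A.l r)))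
  have h2 := neg_le_of_abs_le (newBall_abs_le A b ε hz 0)
  linarith

/-- At a fixed `t`, the term `r` deviates by at most `2 * δ / ε + 2 * c r`. The weights `c r` sum to
at most `1`, so their average contributes only `2 / N`. -/
theorem norm_average_sub_le {N : ℕ} (hN : 0 < N) {δ : ℝ} (hδ : 0 < δ) (x : Fin N → CI)
    (hx : ∀ r, x r ∈ newBall A b ε)
    (hxδ : ∀ r, 2 - δ < x r (b.peak (stageM A.l r)) - x r 0) :
    ‖(∑ r, (N : ℝ)⁻¹ • x r) - ((2 : ℝ) • b.J (e 0) - 1)‖ ≤ 2 * δ / ε + 2 / N := by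
  have hε0 : (0 : ℝ) < ε := ε.2.1
  have hN' : (0 : ℝ) < N := Nat.cast_pos.2 hN
  set base : CI := (2 : ℝ) • b.J (e 0) - 1 with hbase
  have hbase_mem : base ∈ newBall A b ε :=
    centred_subset_newBall A b ε ((mem_centred A b).2 ⟨_, A.e_zero_mem, rfl⟩)
  rw [ContinuousMap.norm_le _ (by positivity)]
  intro t
  obtain ⟨c, hc, hcs, hct⟩ := newBall_close A b ε t
  have h1 : ((∑ r, (N : ℝ)⁻¹ • x r) - base) t = ∑ r, (N : ℝ)⁻¹ * (x r t - base t) := by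
    simp only [ContinuousMap.sub_apply, ContinuousMap.sum_apply, ContinuousMap.smul_apply,
      smul_eq_mul, mul_sub, Finset.sum_sub_distrib, Finset.sum_const, Finset.card_univ,
      Fintype.card_fin, nsmul_eq_mul]
    rw [mul_inv_cancel_left₀ hN'.ne']
  have h2 : ∀ r : Fin N, |x r t - base t| ≤ 2 * δ / ε + 2 * c r := by
    intro r
    have h3 := hct r _ (hx r)
    rw [← hbase] at h3
    have h4 : |x r t - base t| ≤ 2 := by
      have h5 := newBall_abs_le A b ε (hx r) t
      have h6 := newBall_abs_le A b ε hbase_mem t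
      exact (abs_sub _ _).trans (by linarith)
    have h5 : 2 / (ε : ℝ) * (2 + x r 0 - x r (b.peak (stageM A.l r))) ≤ 2 * δ / ε := by
      -- Membership in the slice makes the deficit `2 + x r 0 - x r (peak (m r))` smaller than `δ`.
      rw [div_mul_eq_mul_div]
      have := hxδ r
      gcongr
      linarith
    nlinarith [(hc r).1]
  rw [h1, Real.norm_eq_abs]
  calc |∑ r, (N : ℝ)⁻¹ * (x r t - base t)| ≤ ∑ r, |(N : ℝ)⁻¹ * (x r t - base t)| :=
        Finset.abs_sum_le_sum_abs _ _
    _ = ∑ r, (N : ℝ)⁻¹ * |x r t - base t| := by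
        simp only [abs_mul, abs_of_pos (inv_pos.2 hN')]
    _ ≤ ∑ r : Fin N, (N : ℝ)⁻¹ * (2 * δ / ε + 2 * c r) := by
        gcongr with r
        exact h2 r
    _ = 2 * δ / ε + 2 / N * ∑ r : Fin N, c r := by
        simp only [mul_add, Finset.sum_add_distrib, Finset.sum_const, Finset.card_univ,
          Fintype.card_fin, nsmul_eq_mul, Finset.mul_sum]
        rw [mul_inv_cancel_left₀ hN'.ne']
        congr 1
        refine Finset.sum_congr rfl fun r _ => ?_
        field_simp
    _ ≤ 2 * δ / ε + 2 / N := by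
        have := hcs N
        rw [← Fin.sum_univ_eq_sum_range] at this
        have h3 := mul_le_mul_of_nonneg_left this (by positivity : (0 : ℝ) ≤ 2 / N)
        linarith

theorem exists_small_ccs {η : ℝ} (hη : 0 < η) : ∃ D : Set (Renormed A b ε),
    IsCCS (toRenormed A b ε '' newBall A b ε) D ∧
      (D ∩ toRenormed A b ε '' centred A b).Nonempty ∧ Metric.diam D < η := by
  have hε0 : (0 : ℝ) < ε := ε.2.1
  have hε1 : 0 < 1 - (ε : ℝ) := sub_pos.2 ε.2.2
  -- `ρ` is a sup-norm radius, shared equally between `2 * δ / ε` and `2 / N`. Passing to the new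
  -- norm costs a factor `1 / (1 - ε)`, so the diameter is at most `η / 2`.
  set ρ : ℝ := (1 - ε) * η / 4 with hρ
  have hρ0 : 0 < ρ := by positivity
  obtain ⟨δ, hδ, hδρ⟩ : ∃ δ : ℝ, 0 < δ ∧ 2 * δ / ε = ρ / 2 :=
    ⟨ρ * ε / 4, by positivity, by field_simp; norm_num⟩
  obtain ⟨N, hN⟩ := exists_nat_gt (4 / ρ)
  have hN' : (0 : ℝ) < N := lt_trans (by positivity) hN
  have hN0 : 0 < N := Nat.cast_pos.1 hN'
  have hNρ : 2 / (N : ℝ) < ρ / 2 := by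
    rw [div_lt_iff₀ hρ0] at hN
    rw [div_lt_iff₀ hN']
    linarith
  have hsum : ∑ _i : Fin N, (N : ℝ)⁻¹ = 1 := by
    simp [hN'.ne']
  have hle : (N : ℝ)⁻¹ ≤ 1 := inv_le_one_of_one_le₀ (by exact_mod_cast hN0)
  refine ⟨_, ⟨N, fun _ => (N : ℝ)⁻¹, fun r => {x | x ∈ toRenormed A b ε '' newBall A b ε ∧
    sSup (sliceFunctional A b ε r '' (toRenormed A b ε '' newBall A b ε)) - δ <
      sliceFunctional A b ε r x}, fun _ => ⟨by positivity, hle⟩, hsum,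
    fun r => ⟨_, δ, hδ, rfl⟩, rfl⟩, ?_, ?_⟩
  · refine ⟨∑ r : Fin N, (N : ℝ)⁻¹ • toRenormed A b ε (slicePoint A b r),
      ⟨_, fun r => ⟨⟨_, centred_subset_newBall A b ε (slicePoint_mem A b r), rfl⟩, ?_⟩, rfl⟩,
      ∑ r : Fin N, (N : ℝ)⁻¹ • slicePoint A b r,
      (convex_centred A b).sum_mem (fun _ _ => by positivity) hsum
        fun r _ => slicePoint_mem A b r, ?_⟩
    · rw [sSup_sliceFunctional, sliceFunctional_slicePoint]
      linarith
    · simp only [map_sum, map_smul]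
  -- `base` serves only as a centre; the point of `D` in the centred set is the average of the
  -- `slicePoint`s.
  · set base : CI := (2 : ℝ) • b.J (e 0) - 1
    have key : ∀ x ∈ {z | ∃ x : Fin N → Renormed A b ε, (∀ r : Fin N,
        x r ∈ {x | x ∈ toRenormed A b ε '' newBall A b ε ∧
          sSup (sliceFunctional A b ε r '' (toRenormed A b ε '' newBall A b ε)) - δ <
            sliceFunctional A b ε r x}) ∧ z = ∑ r, (N : ℝ)⁻¹ • x r},
        ‖x - toRenormed A b ε base‖ ≤ ρ / (1 - ε) := by
      rintro _ ⟨x, hx, rfl⟩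
      choose hx1 hx2 using hx
      choose y hy hyx using hx1
      obtain rfl : x = fun r => toRenormed A b ε (y r) := funext fun r => (hyx r).symm
      simp only [sSup_sliceFunctional, sliceFunctional_apply] at hx2
      have h1 := norm_average_sub_le A b ε hN0 hδ y hy hx2
      have h2 := norm_toRenormed_le A b ε ((∑ r, (N : ℝ)⁻¹ • y r) - base)
      rw [map_sub, map_sum] at h2
      simp only [map_smul] at h2
      refine h2.trans ?_
      gcongr
      exact h1.trans (by linarith)
    have hlt : 2 * (ρ / (1 - ε)) < η := by
      rw [hρ]
      field_simp
      linarith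
    refine lt_of_le_of_lt (Metric.diam_le_of_forall_dist_le (by positivity) ?_) hlt
    intro x hx y hy
    calc dist x y ≤ dist x (toRenormed A b ε base) + dist y (toRenormed A b ε base) :=
          dist_triangle_right _ _ _
      _ ≤ 2 * (ρ / (1 - ε)) := by
          rw [dist_eq_norm, dist_eq_norm]
          linarith [key x hx, key y hy]

end Ball

end AOR

/-- A convergent sequence in the weak topology eventually belongs to a weakly open set. -/
theorem eventually_mem_of_weak_tendsto {X : Type*} [NormedAddCommGroup X] [NormedSpace ℝ X]
    {U : Set (WeakSpace ℝ X)} (hU : IsOpen U) {y : ℕ → X} {x : X} (hx : toWeakSpace ℝ X x ∈ U)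
    (hy : ∀ f : X →L[ℝ] ℝ, Tendsto (fun n => f (y n)) atTop (𝓝 (f x))) :
    ∀ᶠ n in atTop, toWeakSpace ℝ X (y n) ∈ U := by
  have h : Tendsto (fun n => toWeakSpace ℝ X (y n)) atTop (𝓝 (toWeakSpace ℝ X x)) := by
    have hi : IsInducing fun (z : WeakSpace ℝ X) (f : X →L[ℝ] ℝ) => f ((toWeakSpace ℝ X).symm z) :=
      ⟨rfl⟩
    rw [hi.tendsto_nhds_iff, tendsto_pi_nhds]
    exact hy
  exact h.eventually (hU.mem_nhds hx)

/-! ### Weakly null sequences of bumps -/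

namespace AOR

/-- Functions dominated by pairwise disjoint bumps tend weakly to zero. -/
theorem Bumps.tendsto_functional (b : Bumps) {φ : ℕ → CI} {C : ℝ}
    (hφ : ∀ k t, |φ k t| ≤ C * b.h k t) (F : CI →L[ℝ] ℝ) :
    Tendsto (fun k => F (φ k)) atTop (𝓝 0) := by
  have hC : 0 ≤ C := by
    have := (abs_nonneg _).trans (hφ 0 (b.peak 0))
    rwa [b.h_peak, mul_one] at this
  -- Signed partial sums have sup norm at most `C`, since at most one term is nonzero at each point;
  -- testing `F` on them bounds the sums of `|F (φ k)|`.
  have hs : Summable fun k => |F (φ k)| := by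
    refine summable_of_sum_le (c := ‖F‖ * C) (fun _ => abs_nonneg _) fun u => ?_
    have h1 : ∑ k ∈ u, |F (φ k)| = F (∑ k ∈ u, (SignType.sign (F (φ k)) : ℝ) • φ k) := by
      simp only [map_sum, map_smul, smul_eq_mul, sign_mul_self]
    rw [h1]
    refine (le_abs_self _).trans ((F.le_opNorm _).trans ?_)
    refine mul_le_mul_of_nonneg_left ?_ (norm_nonneg F)
    rw [ContinuousMap.norm_le _ hC]
    intro t
    obtain ⟨n, hn⟩ := b.exists_idx t
    have h0 : ∀ k, k ≠ n → φ k t = 0 := fun k hk => by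
      have := hφ k t
      rw [hn k hk, mul_zero] at this
      exact abs_nonpos_iff.1 this
    have h2 : |φ n t| ≤ C := (hφ n t).trans (mul_le_of_le_one_right hC (b.h_le_one n t))
    simp only [ContinuousMap.sum_apply, ContinuousMap.smul_apply, smul_eq_mul]
    by_cases hnu : n ∈ u
    · rw [Finset.sum_eq_single n (fun k _ hk => by rw [h0 k hk, mul_zero])
        fun h => absurd hnu h, Real.norm_eq_abs, abs_mul]
      refine le_trans (mul_le_of_le_one_left (abs_nonneg _) ?_) h2
      rcases SignType.sign (F (φ n)) with _ | _ | _ <;> simp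
    · rw [Finset.sum_eq_zero, norm_zero]
      · exact hC
      · intro k hk
        rw [h0 k fun h => hnu (h ▸ hk), mul_zero]
  exact (tendsto_zero_iff_abs_tendsto_zero _).2 hs.tendsto_atTop_zero

/-! ### The super Daugavet property of the centred set -/

section SuperDaugavet

variable (A : Construction) (b : Bumps) (ε : Set.Ioo (0 : ℝ) 1)

/-- The part of `B_ε` which is perturbed along every bump. -/
def restHull (A : Construction) (b : Bumps) (ε : ℝ) : Set CI :=
  convexHull ℝ ((fun a => 1 - (2 : ℝ) • a) '' K0 A b ∪ thickBall ε)

theorem zero_mem_thickBall (ε : ℝ) : (0 : CI) ∈ thickBall ε :=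
  ⟨0, 0, by simp, by simp, by simp, by simp⟩

theorem restHull_subset : restHull A b ε ⊆ newBall A b ε := by
  refine convexHull_min ?_ (convex_newBall A b ε)
  rintro _ (⟨_, ⟨a, ha, rfl⟩, rfl⟩ | hz)
  · have := newBall_neg A b ε (centred_subset_newBall A b ε ((mem_centred A b).2 ⟨a, ha, rfl⟩))
    simpa using this
  · exact subset_closedConvexHull (Or.inr hz)

/-- Splitting off `centred` separates the two kinds of weak perturbation: its points move along the
tree, those of `restHull` along arbitrary bumps. -/
theorem newBall_eq_closure :
    newBall A b ε = closure (convexHull ℝ (centred A b ∪ restHull A b ε)) := by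
  have h : (fun a : CI => (2 : ℝ) • (-a + (1 / 2 : ℝ) • (1 : CI))) =
      fun a => 1 - (2 : ℝ) • a := by
    funext a
    module
  rw [newBall, closedConvexHull_eq_closure_convexHull, restHull, convexHull_convexHull_union_right,
    h, Set.union_assoc]

/-- Pointwise, `f + (1 - f) h` is a convex combination of `f` and `1`, so the unit ball is
preserved; so is vanishing at `0`, where `h` vanishes. The operation is affine, hence acts on both
summands of the thick ball separately. -/
theorem thickBall_add_bump_mem {ε : ℝ} {z : CI} (hz : z ∈ thickBall ε) (k : ℕ) : z + (1 - z) * b.h k ∈ thickBall ε := by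
  have key : ∀ f : CI, ‖f‖ ≤ 1 → ‖f + (1 - f) * b.h k‖ ≤ 1 := by
    intro f hf
    rw [ContinuousMap.norm_le _ zero_le_one]
    intro t
    have h1 := abs_le.1 ((f.norm_coe_le_norm t).trans hf)
    have h2 := b.h_nonneg k t
    have h3 := b.h_le_one k t
    simp only [ContinuousMap.add_apply, ContinuousMap.mul_apply, ContinuousMap.sub_apply,
      ContinuousMap.one_apply, Real.norm_eq_abs, abs_le]
    constructor <;> nlinarith [h1.1, h1.2]
  obtain ⟨f, q, hf, hq, hq0, rfl⟩ := hz
  refine ⟨_, _, key f hf, key q hq, ?_, ?_⟩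
  · simp [hq0, b.h_zero]
  · ext t
    simp only [ContinuousMap.add_apply, ContinuousMap.mul_apply, ContinuousMap.sub_apply,
      ContinuousMap.one_apply, ContinuousMap.smul_apply, smul_eq_mul]
    ring

/-- Elements of the hull of `1 - 2 K₀` and the thick ball can be moved weakly towards the value
`1` at the peaks. -/
theorem exists_perturbation {y : CI} (hy : y ∈ restHull A b ε) : ∃ φ : ℕ → CI,
    (∀ k t, |φ k t| ≤ 2 * b.h k t) ∧ (∀ k, y + φ k ∈ newBall A b ε) ∧
    Tendsto (fun k => (y + φ k) (b.peak k)) atTop (𝓝 1) := by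
  refine convexHull_min (t := {y | ∃ φ : ℕ → CI,
    (∀ k t, |φ k t| ≤ 2 * b.h k t) ∧ (∀ k, y + φ k ∈ newBall A b ε) ∧
    Tendsto (fun k => (y + φ k) (b.peak k)) atTop (𝓝 1)}) ?_ ?_ hy
  · rintro _ (⟨_, ⟨a, ha, rfl⟩, rfl⟩ | hz)
    -- No perturbation is needed: `a` is in `c₀`, so `1 - 2 J a` already tends to `1` along the
    -- peaks.
    · refine ⟨0, fun k t => ?_, fun k => ?_, ?_⟩
      · simpa using b.h_nonneg k t
      · simpa using restHull_subset A b ε (subset_convexHull ℝ _ (Or.inl ⟨_, ⟨a, ha, rfl⟩, rfl⟩))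
      · have := ((tendsto_coord a).const_mul 2).const_sub 1
        simpa [b.J_peak] using this
    · rename_i z
      have hzb : z ∈ newBall A b ε := subset_closedConvexHull (Or.inr hz)
      refine ⟨fun k => (1 - z) * b.h k, fun k t => ?_, fun k =>
        subset_closedConvexHull (Or.inr (thickBall_add_bump_mem b hz k)), ?_⟩
      · have h1 := abs_le.1 (newBall_abs_le A b ε hzb t)
        simp only [ContinuousMap.mul_apply, ContinuousMap.sub_apply, ContinuousMap.one_apply,
          abs_mul, abs_of_nonneg (b.h_nonneg k t)]
        refine mul_le_mul_of_nonneg_right ?_ (b.h_nonneg k t)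
        rw [abs_le]
        constructor <;> linarith [h1.1, h1.2]
      · simp [b.h_peak]
  · rintro x ⟨φ, h1, h2, h3⟩ y ⟨ψ, h4, h5, h6⟩ p q hp hq hpq
    have hsum : ∀ k, p • x + q • y + (p • φ k + q • ψ k) = p • (x + φ k) + q • (y + ψ k) :=
      fun k => by module
    refine ⟨fun k => p • φ k + q • ψ k, fun k t => ?_, fun k => ?_, ?_⟩
    · simp only [ContinuousMap.add_apply, ContinuousMap.smul_apply, smul_eq_mul]
      calc |p * φ k t + q * ψ k t| ≤ p * |φ k t| + q * |ψ k t| := by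
            refine (abs_add_le _ _).trans_eq ?_
            rw [abs_mul, abs_mul, abs_of_nonneg hp, abs_of_nonneg hq]
        _ ≤ p * (2 * b.h k t) + q * (2 * b.h k t) := by
            gcongr
            · exact h1 k t
            · exact h4 k t
        _ = 2 * b.h k t := by linear_combination (2 * b.h k t) * hpq
    · rw [hsum]
      exact convex_newBall A b ε (h2 k) (h5 k) hp hq hpq
    · simp only [hsum]
      have := (h3.const_mul p).add (h6.const_mul q)
      rw [mul_one, mul_one, hpq] at this
      exact this

theorem Construction.exists_g_near {a : C0} (ha : a ∈ A.K0) {δ : ℝ} (hδ : 0 < δ) :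
    ∃ n, ∃ j < A.l n, ‖a - A.g j‖ < δ := by
  obtain ⟨a', ha', hd⟩ := Metric.mem_closure_iff.1 ha (δ / 2) (half_pos hδ)
  obtain ⟨n, hn⟩ := Set.mem_iUnion.1 ha'
  obtain ⟨p, hp⟩ := (A.eps_tendsto.eventually (gt_mem_nhds (half_pos hδ))).exists
  -- The stage must contain `a'` and also have mesh below `δ / 2`.
  obtain ⟨j, hj, hg⟩ := A.g_net (max n p) a' (A.monotone_stageK (le_max_left n p) hn)
  refine ⟨_, j, hj, ?_⟩
  rw [dist_eq_norm] at hd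
  calc ‖a - A.g j‖ ≤ ‖a - a'‖ + ‖a' - A.g j‖ := norm_sub_le_norm_sub_add_norm_sub _ _ _
    _ < δ := by linarith [A.eps_antitone (le_max_right n p)]

/-- Every norm open set which meets `B_ε` contains a convex combination of some `2 (g j - 𝟙/2)`
and of an element of `restHull`. -/
theorem exists_combination_mem {O : Set CI} (hO : IsOpen O) {y : CI} (hy : y ∈ newBall A b ε)
    (hyO : y ∈ O) : ∃ n, ∃ j < A.l n, ∃ z ∈ restHull A b ε, ∃ p q : ℝ, 0 ≤ p ∧ 0 ≤ q ∧ p + q = 1 ∧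
      p • ((2 : ℝ) • b.J (A.g j) - 1) + q • z ∈ O := by
  rw [newBall_eq_closure] at hy
  obtain ⟨w, hwO, hw⟩ := mem_closure_iff.1 hy O hO hyO
  have hrest : Convex ℝ (restHull A b ε) := convex_convexHull ℝ _
  rw [(convex_centred A b).convexHull_union hrest
    ⟨_, slicePoint_mem A b 0⟩ ⟨0, subset_convexHull ℝ _ (Or.inr (zero_mem_thickBall _))⟩,
    mem_convexJoin] at hw
  obtain ⟨x, hx, z, hz, p, q, hp, hq, hpq, rfl⟩ := hw
  obtain ⟨a, ha, rfl⟩ := (mem_centred A b).1 hx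
  -- Continuity allows `a` to be replaced by a net point; only net points are known to have
  -- successors at all later stages.
  have hc : Continuous fun a : C0 => p • ((2 : ℝ) • b.J a - 1) + q • z := by
    have := b.J.continuous
    fun_prop
  obtain ⟨δ, hδ, hball⟩ := Metric.isOpen_iff.1 (hO.preimage hc) a hwO
  obtain ⟨n, j, hj, hg⟩ := A.exists_g_near ha hδ
  refine ⟨n, j, hj, z, hz, p, q, hp, hq, hpq, hball ?_⟩
  rwa [Metric.mem_ball', dist_eq_norm]

/-- The lower bound is read off at `0`, where all bumps vanish and the value is `-1`. -/
theorem norm_centred {x : CI} (hx : x ∈ centred A b) : ‖toRenormed A b ε x‖ = 1 := by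
  refine le_antisymm (norm_toRenormed_le_one A b ε (centred_subset_newBall A b ε hx)) ?_
  refine le_trans ?_ (norm_le_norm_toRenormed A b ε x)
  obtain ⟨a, -, rfl⟩ := (mem_centred A b).1 hx
  have := ((2 : ℝ) • b.J a - 1 : CI).norm_coe_le_norm 0
  simpa [b.J_zero] using this

theorem isSuperDaugavetPoint_centred {x : CI} (hx : x ∈ centred A b) :
    IsSuperDaugavetPoint (toRenormed A b ε x) := by
  refine ⟨norm_centred A b ε hx, ?_⟩
  rintro W ⟨⟨y₀, hy₀⟩, U, hU, rfl⟩
  refine ⟨?_, fun c hc => ?_⟩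
  · rintro _ ⟨y, ⟨hy, -⟩, rfl⟩
    rw [mem_closedBall_zero_iff] at hy
    have := norm_sub_le (toRenormed A b ε x) y
    rw [norm_centred A b ε hx] at this
    dsimp only
    linarith
  rw [closedBall_renormed] at hy₀ hc
  obtain ⟨⟨y, hy, rfl⟩, hyU⟩ := hy₀
  -- Weakly open sets are norm open, so the density argument applies before any weak limit is taken.
  have hO : IsOpen ((fun z : CI => toWeakSpace ℝ (Renormed A b ε) (renormEquiv A b ε z)) ⁻¹' U) :=
    hU.preimage ((toWeakSpaceCLM ℝ (Renormed A b ε)).continuous.comp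
      (renormEquiv A b ε).continuous)
  obtain ⟨n₀, j, hj, z, hz, p, q, hp, hq, hpq, hw⟩ := exists_combination_mem A b ε hO hy hyU
  obtain ⟨φ, hφ, hφB, hφ1⟩ := exists_perturbation A b ε hz
  set w : CI := p • ((2 : ℝ) • b.J (A.g j) - 1) + q • z with hwdef
  -- The fresh coordinate given to `g j` at stage `n₀ + n`; starting at `n₀` ensures that `j` is
  -- already in the net.
  set κ : ℕ → ℕ := fun n => stageM A.l (n₀ + n) + j with hκ
  have hκ_tendsto : Tendsto κ atTop atTop := by
    refine StrictMono.tendsto_atTop fun m n hmn => ?_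
    have := A.stageM_strictMono (Nat.add_lt_add_left hmn n₀)
    simp only [hκ]
    omega
  have hjn : ∀ n, j < A.l (n₀ + n) := fun n =>
    lt_of_lt_of_le hj (A.l_mono (Nat.le_add_right _ _))
  set ψ : ℕ → CI := fun k => (2 * p) • b.h k + q • φ k with hψ
  have hψ_le : ∀ k t, |ψ k t| ≤ (2 * p + 2 * q) * b.h k t := by
    intro k t
    simp only [hψ, ContinuousMap.add_apply, ContinuousMap.smul_apply, smul_eq_mul]
    refine (abs_add_le _ _).trans ?_
    rw [abs_mul (2 * p), abs_mul q, abs_of_nonneg (by linarith : 0 ≤ 2 * p), abs_of_nonneg hq,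
      abs_of_nonneg (b.h_nonneg k t)]
    nlinarith [hφ k t]
  have hsplit : ∀ n, w + ψ (κ n) =
      p • ((2 : ℝ) • b.J (A.g j + e (κ n)) - 1) + q • (z + φ (κ n)) := by
    intro n
    rw [map_add, b.J_e, hwdef, hψ]
    module
  have hmem : ∀ n, w + ψ (κ n) ∈ newBall A b ε := by
    intro n
    rw [hsplit]
    exact convex_newBall A b ε (centred_subset_newBall A b ε
      ((mem_centred A b).2 ⟨_, A.vertex_mem (hjn n), rfl⟩)) (hφB _) hp hq hpq
  have hU' : ∀ᶠ n in atTop,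
      toWeakSpace ℝ (Renormed A b ε) (toRenormed A b ε (w + ψ (κ n))) ∈ U := by
    refine eventually_mem_of_weak_tendsto hU (x := toRenormed A b ε w) hw fun f => ?_
    have h1 := (b.tendsto_functional hψ_le
      (f.comp (renormEquiv A b ε : CI →L[ℝ] Renormed A b ε))).comp hκ_tendsto
    have h2 := h1.const_add (f (toRenormed A b ε w))
    rw [add_zero] at h2
    refine h2.congr fun n => ?_
    rw [map_add (toRenormed A b ε) w, map_add f]
    rfl
  -- At the peak the perturbed point has value `p + q * (z + φ) → p + q = 1`, while `x` tends to
  -- `-1`.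
  have hval : Tendsto (fun n => (w + ψ (κ n)) (b.peak (κ n)) - x (b.peak (κ n))) atTop
      (𝓝 2) := by
    obtain ⟨a, -, rfl⟩ := (mem_centred A b).1 hx
    have h1 : ∀ n, (w + ψ (κ n)) (b.peak (κ n)) =
        p + q * (z + φ (κ n)) (b.peak (κ n)) := by
      intro n
      rw [hsplit]
      have h0 : A.g j (κ n) = 0 := A.g_apply_new (hjn n) (Nat.le_add_right _ _)
      simp only [ContinuousMap.add_apply, ContinuousMap.sub_apply, ContinuousMap.smul_apply,
        smul_eq_mul, b.J_peak, ZeroAtInftyContinuousMap.add_apply, h0, e_self,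
        ContinuousMap.one_apply]
      ring
    have h2 : ∀ n, ((2 : ℝ) • b.J a - 1 : CI) (b.peak (κ n)) = 2 * a (κ n) - 1 := by
      intro n
      simp [b.J_peak]
    simp only [h1, h2]
    have h3 := ((hφ1.comp hκ_tendsto).const_mul q).const_add p
    have h4 := (((tendsto_coord a).comp hκ_tendsto).const_mul 2).sub_const 1
    have h5 := h3.sub h4
    rw [mul_one, hpq] at h5
    rw [show (1 : ℝ) - (2 * 0 - 1) = 2 by norm_num] at h5
    exact h5
  refine le_of_tendsto hval (hU'.mono fun n hn => ?_)
  refine le_trans ?_ (hc ⟨_, ⟨⟨_, hmem n, rfl⟩, hn⟩, rfl⟩)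
  dsimp only
  rw [← map_sub]
  refine le_trans ?_ (norm_le_norm_toRenormed A b ε _)
  refine le_trans ?_ ((x - (w + ψ (κ n))).norm_coe_le_norm (b.peak (κ n)))
  rw [Real.norm_eq_abs, ContinuousMap.sub_apply, abs_sub_comm]
  exact le_abs_self _

end SuperDaugavet


/-! ### Existence of the data -/

/-- The convex hull of a finite set has finite nets of every mesh. -/
theorem exists_net {K : Set C0} (hK : ∃ F : Set C0, F.Finite ∧ K = convexHull ℝ F) {r : ℝ}
    (hr : 0 < r) : ∃ G : List C0, (∀ x ∈ G, x ∈ K) ∧ ∀ x ∈ K, ∃ y ∈ G, ‖x - y‖ ≤ r := by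
  obtain ⟨F, hF, rfl⟩ := hK
  obtain ⟨t, htK, htf, hcov⟩ := (hF.isCompact_convexHull ℝ).finite_cover_balls hr
  refine ⟨htf.toFinset.toList, fun x hx => htK (by simpa using hx), fun x hx => ?_⟩
  obtain ⟨y, hy, hxy⟩ := Set.mem_iUnion₂.1 (hcov hx)
  refine ⟨y, by simpa using hy, ?_⟩
  rw [Metric.mem_ball, dist_eq_norm] at hxy
  exact hxy.le

/-- A stage of the construction: the set, the number of used coordinates and the chosen points. -/
structure Stage where
  K : Set C0
  m : ℕ
  G : List C0
  hK : ∃ F : Set C0, F.Finite ∧ K = convexHull ℝ F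

namespace Stage

/-- The set of the next stage. -/
def nextK (s : Stage) : Set C0 :=
  convexHull ℝ (s.K ∪ {x | ∃ i < s.G.length, x = s.G.getD i 0 + e (s.m + i)})

theorem nextK_finite (s : Stage) : ∃ F : Set C0, F.Finite ∧ s.nextK = convexHull ℝ F := by
  obtain ⟨F, hF, hK⟩ := s.hK
  refine ⟨F ∪ {x | ∃ i < s.G.length, x = s.G.getD i 0 + e (s.m + i)}, hF.union ?_, ?_⟩
  · refine ((Set.finite_lt_nat s.G.length).image fun i => s.G.getD i 0 + e (s.m + i)).subset ?_
    rintro x ⟨i, hi, rfl⟩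
    exact ⟨i, hi, rfl⟩
  · rw [nextK, hK, convexHull_convexHull_union_left]

/-- The next stage, with a net of mesh `r`. -/
noncomputable def next (s : Stage) {r : ℝ} (hr : 0 < r) : Stage where
  K := s.nextK
  m := s.m + s.G.length
  G := s.G ++ (exists_net s.nextK_finite hr).choose
  hK := s.nextK_finite

end Stage

/-- The stages for the meshes `1 / (n + 1)`. -/
noncomputable def stageSeq : ℕ → Stage
  | 0 => ⟨{e 0}, 1, [e 0], {e 0}, Set.finite_singleton _, (convexHull_singleton _).symm⟩
  | n + 1 => (stageSeq n).next (Nat.one_div_pos_of_nat (α := ℝ) (n := n + 1))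

theorem stageSeq_prefix {m n : ℕ} (h : m ≤ n) : (stageSeq m).G <+: (stageSeq n).G := by
  induction h with
  | refl => exact List.prefix_refl _
  | step _ ih => exact ih.trans (List.prefix_append _ _)

theorem e_zero_mem_stageSeq (n : ℕ) : e 0 ∈ (stageSeq n).K := by
  induction n with
  | zero => exact rfl
  | succ n ih => exact subset_convexHull ℝ _ (Or.inl ih)

/-- Each added net is non-empty because its set contains `e 0`. Thus entry `i` exists from stage `i`
on, and the default `0` in `netSeq` is never used. -/
theorem stageSeq_length (n : ℕ) : n < (stageSeq n).G.length := by
  induction n with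
  | zero => simp [stageSeq]
  | succ n ih =>
    have h := (exists_net (stageSeq n).nextK_finite
      (Nat.one_div_pos_of_nat (α := ℝ) (n := n + 1))).choose_spec.2 _
        (e_zero_mem_stageSeq (n + 1))
    obtain ⟨y, hy, -⟩ := h
    have := List.length_pos_of_mem hy
    simp only [stageSeq, Stage.next, List.length_append]
    omega

/-- The sequence of all chosen points. -/
noncomputable def netSeq (i : ℕ) : C0 := (stageSeq i).G.getD i 0

/-- The lists are prefixes of one another, so an entry does not depend on the stage at which it is
read. -/
theorem netSeq_eq {n i : ℕ} (h : i < (stageSeq n).G.length) :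
    netSeq i = (stageSeq n).G.getD i 0 := by
  have hi := stageSeq_length i
  rw [netSeq, List.getD_eq_getElem _ _ hi, List.getD_eq_getElem _ _ h]
  rcases le_total i n with hin | hin
  · exact (stageSeq_prefix hin).getElem hi
  · exact ((stageSeq_prefix hin).getElem h).symm

theorem stageM_stageSeq (n : ℕ) :
    stageM (fun n => (stageSeq n).G.length) n = (stageSeq n).m := by
  induction n with
  | zero => rfl
  | succ n ih => simp only [stageM, ih]; rfl

theorem stageK_stageSeq (n : ℕ) :
    stageK (fun n => (stageSeq n).G.length) netSeq n = (stageSeq n).K := by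
  induction n with
  | zero => rfl
  | succ n ih =>
    simp only [stageK, ih, stageM_stageSeq]
    change _ = (stageSeq n).nextK
    rw [Stage.nextK]
    congr 2
    ext x
    refine exists_congr fun i => and_congr_right fun hi => ?_
    rw [netSeq_eq hi]

theorem stageSeq_mem (n : ℕ) : ∀ x ∈ (stageSeq n).G, x ∈ (stageSeq n).K := by
  induction n with
  | zero => intro x hx; simpa [stageSeq] using hx
  | succ n ih =>
    intro x hx
    rcases List.mem_append.1 hx with hx | hx
    · exact subset_convexHull ℝ _ (Or.inl (ih x hx))
    · exact (exists_net (stageSeq n).nextK_finite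
        (Nat.one_div_pos_of_nat (α := ℝ) (n := n + 1))).choose_spec.1 x hx

theorem stageSeq_net (n : ℕ) : ∀ x ∈ (stageSeq n).K, ∃ y ∈ (stageSeq n).G,
    ‖x - y‖ ≤ 1 / ((n : ℝ) + 1) := by
  cases n with
  | zero =>
    intro x hx
    obtain rfl : x = e 0 := hx
    exact ⟨e 0, by simp [stageSeq], by simp⟩
  | succ n =>
    intro x hx
    obtain ⟨y, hy, h⟩ := (exists_net (stageSeq n).nextK_finite
      (Nat.one_div_pos_of_nat (α := ℝ) (n := n + 1))).choose_spec.2 x hx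
    exact ⟨y, List.mem_append_right _ hy, h⟩

theorem nonempty_construction : Nonempty Construction := by
  refine ⟨{
    eps := fun n => 1 / ((n : ℝ) + 1)
    eps_pos := fun n => Nat.one_div_pos_of_nat
    eps_antitone := fun m n h => Nat.one_div_le_one_div h
    eps_tendsto := tendsto_one_div_add_atTop_nhds_zero_nat
    l := fun n => (stageSeq n).G.length
    l_zero := rfl
    l_mono := fun m n h => (stageSeq_prefix h).length_le
    g := netSeq
    g_zero := rfl
    g_mem := fun n i hi => ?_
    g_net := fun n x hx => ?_ }⟩
  · rw [stageK_stageSeq, netSeq_eq hi, List.getD_eq_getElem _ _ hi]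
    exact stageSeq_mem n _ (List.getElem_mem hi)
  · rw [stageK_stageSeq] at hx
    obtain ⟨y, hy, h⟩ := stageSeq_net n x hx
    obtain ⟨i, hi, rfl⟩ := List.getElem_of_mem hy
    refine ⟨i, hi, ?_⟩
    rwa [netSeq_eq hi, List.getD_eq_getElem _ _ hi]

/-- The hat function with peak at `2⁻ⁿ`. -/
def hat (n : ℕ) : CI where
  toFun t := max 0 (1 - 4 * |2 ^ n * (t : ℝ) - 1|)
  continuous_toFun := by fun_prop

theorem hat_le_one (n : ℕ) (t : unitInterval) : hat n t ≤ 1 :=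
  max_le zero_le_one (by linarith [abs_nonneg (2 ^ n * (t : ℝ) - 1)])

theorem nonempty_bumps : Nonempty Bumps := by
  refine ⟨{
    V := fun n => {t | 4 * |2 ^ n * (t : ℝ) - 1| < 1}
    V_open := fun n => isOpen_lt (by fun_prop) continuous_const
    V_disjoint := ?_
    V_zero := fun n => ?_
    h := hat
    h_nonneg := fun n t => le_max_left _ _
    h_le_one := hat_le_one
    h_norm := fun n => ?_
    h_support := fun n t ht => ?_ }⟩
  · refine (pairwise_disjoint_on _).2 fun m n hmn => Set.disjoint_left.2 fun t hm hn => ?_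
    have hm' : 4 * |2 ^ m * (t : ℝ) - 1| < 1 := hm
    have hn' : 4 * |2 ^ n * (t : ℝ) - 1| < 1 := hn
    have h1 := neg_abs_le (2 ^ m * (t : ℝ) - 1)
    have h2 := le_abs_self (2 ^ n * (t : ℝ) - 1)
    -- Here `2 ^ m * t > 3 / 4` and `2 ^ n * t < 5 / 4`, which contradicts `2 ^ n * t ≥ 2 * (2 ^ m *
    -- t)`.
    have h3 : (2 : ℝ) * 2 ^ m ≤ 2 ^ n := by
      rw [← pow_succ']
      exact pow_le_pow_right₀ one_le_two hmn
    have h4 := mul_le_mul_of_nonneg_right h3 t.2.1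
    linarith
  · simp
  · refine le_antisymm ((ContinuousMap.norm_le _ zero_le_one).2 fun t => ?_) ?_
    · rw [Real.norm_of_nonneg (show 0 ≤ hat n t from le_max_left _ _)]
      exact hat_le_one n t
    · have hp : ((2 : ℝ) ^ n)⁻¹ ∈ Set.Icc (0 : ℝ) 1 :=
        ⟨by positivity, inv_le_one_of_one_le₀ (one_le_pow₀ one_le_two)⟩
      have h1 := (hat n).norm_coe_le_norm ⟨_, hp⟩
      have h2 : hat n ⟨_, hp⟩ = 1 := by simp [hat]
      rwa [h2, norm_one] at h1
  · by_contra h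
    refine ht (max_eq_left ?_)
    have : 1 ≤ 4 * |2 ^ n * (t : ℝ) - 1| := not_lt.1 h
    linarith

/-! ### A super Daugavet point which is not a ccs Δ-point -/

theorem exists_not_isCCSDeltaPoint (A : Construction) (b : Bumps) (ε : Set.Ioo (0 : ℝ) 1) :
    ∃ x : Renormed A b ε, IsSuperDaugavetPoint x ∧ ¬ IsCCSDeltaPoint x := by
  obtain ⟨D, hD, ⟨_, hxD, x, hx, rfl⟩, hdiam⟩ := exists_small_ccs A b ε one_pos
  refine ⟨_, isSuperDaugavetPoint_centred A b ε hx, fun h => ?_⟩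
  rw [← closedBall_renormed] at hD
  -- Boundedness matters: `Metric.diam` of an unbounded set is `0` by convention and would bound no
  -- distance.
  have hsub : D ⊆ Metric.closedBall 0 1 := by
    obtain ⟨n, lam, S, hlam, hsum, hS, rfl⟩ := hD
    rintro _ ⟨y, hy, rfl⟩
    refine (convex_closedBall _ _).sum_mem (fun i _ => (hlam i).1.le) hsum fun i _ => ?_
    obtain ⟨f, δ, -, hSi⟩ := hS i
    have := hy i
    rw [hSi] at this
    exact this.1
  have hle : (2 : ℝ) ≤ 1 := (h.2 D hD hxD).2 <| by
    rintro _ ⟨y, hy, rfl⟩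
    have := Metric.dist_le_diam_of_mem (Metric.isBounded_closedBall.subset hsub) hxD hy
    rw [dist_eq_norm] at this
    exact this.trans hdiam.le
  norm_num at hle

end AOR

theorem mainTheorem9 :
    (∀ (A : AOR.Construction) (b : AOR.Bumps) (ε : Set.Ioo (0 : ℝ) 1),
      (∀ x ∈ AOR.centred A b, IsSuperDaugavetPoint (AOR.toRenormed A b ε x)) ∧
      (∀ η : ℝ, 0 < η → ∃ D : Set (AOR.Renormed A b ε),
        IsCCS (AOR.toRenormed A b ε '' AOR.newBall A b ε) D ∧
          (D ∩ AOR.toRenormed A b ε '' AOR.centred A b).Nonempty ∧ Metric.diam D < η) ∧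
      (∃ x : AOR.Renormed A b ε, IsSuperDaugavetPoint x ∧ ¬ IsCCSDeltaPoint x)) ∧
    (∃ (X : Type) (_ : NormedAddCommGroup X) (_ : NormedSpace ℝ X) (_ : CompleteSpace X) (x : X),
      IsSuperDaugavetPoint x ∧ ¬ IsCCSDeltaPoint x) := by
  refine ⟨fun A b ε => ⟨fun x hx => AOR.isSuperDaugavetPoint_centred A b ε hx,
    fun η hη => AOR.exists_small_ccs A b ε hη, AOR.exists_not_isCCSDeltaPoint A b ε⟩, ?_⟩
  obtain ⟨A⟩ := AOR.nonempty_construction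
  obtain ⟨b⟩ := AOR.nonempty_bumps
  let ε : Set.Ioo (0 : ℝ) 1 := ⟨1 / 2, by norm_num⟩
  exact ⟨AOR.Renormed A b ε, inferInstance, inferInstance, AOR.completeSpace_renormed A b ε,
    AOR.exists_not_isCCSDeltaPoint A b ε⟩
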